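/- Theorem (Moser method for Poisson manifolds). Let $M$ be a (finite-dimensional, Hausdorff, smooth) manifold without boundary and let $J\subseteq\mathbb{R}$ be an interval containing $0$. Let $(\pi_t)_{t\in J}$ be a smooth family of Poisson structures on $M$, $(\omega_t)_{t\in J}$ a smooth family of closed 2-forms, and $(a_t)_{t\in J}$ a smooth family of 1-forms on $M$. For a bivector field $\pi$ write $\pi^\sharp\colon T^*M\to TM$, $\mu\mapsto\pi(\mu,\cdot)$, and $\mathrm{Gr}(\pi)=\{\pi^\sharp(\mu)+\mu\}\subseteq TM\oplus T^*M$; for a 2-form $\omega$ write $\mathcal{R}_\omega(v+\mu)=v+\mu+\iota_v\omega$. Suppose that for all $t\in J$ $$\pi_t=(\pi_0)^{\omega_t},\ \text{ i.e. }\ \mathcal{R}_{\omega_t}(\mathrm{Gr}(\pi_0))=\mathrm{Gr}(\pi_t),\qquad\text{and}\qquad \frac{d\omega_t}{dt}=-\,\mathrm{d}a_t .$$ Let $X_t=\pi_t^\sharp(a_t)$, and let $\Phi_t$ be the (possibly only local) flow of the time-dependent vector field $X_t$, starting at time $0$, with the convention $$\frac{d}{dt}(\Phi_t)_*=(\Phi_t)_*\circ\mathcal{L}_{X_t}\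 \text{ on functions},\qquad (\Phi_t)_*f=f\circ\Phi_t^{-1};$$ that is, $t\mapsto\Phi_t^{-1}(y)$ is the solution of $\dot x=X_t(x)$, $x(0)=y$. Here $\Phi_t$ is a diffeomorphism between open subsets of $M$, its target is contained in that of $\Phi_s$ for every $s$ between $0$ and $t$, and $\Phi_t^{-1}(y)$ depends smoothly on $(t,y)$; if $X_t$ is complete, $\Phi_t$ may be taken to be a diffeomorphism of $M$. Then for all $t\in J$, on the target of $\Phi_t$, $$(\Phi_t)_*\pi_t=\pi_0 .$$ -/

import Mathlib

open Set
open scoped Manifold ContDiff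

noncomputable section

namespace PoissonMoser

/-! ### Linear algebra on one tangent space -/

section Linear

variable {V : Type*} [AddCommGroup V] [Module ℝ V] [TopologicalSpace V]

/-- The contraction `ι_v Ω = Ω(v, ·)` of a 2-form. -/
def contract (Ω : V [⋀^Fin 2]→L[ℝ] ℝ) (v : V) : V →L[ℝ] ℝ :=
  Ω.toContinuousMultilinearMap.toContinuousLinearMap ![v, 0] 1

theorem contract_apply (Ω : V [⋀^Fin 2]→L[ℝ] ℝ) (v w : V) :
    contract Ω v w = Ω ![v, w] := by
  change Ω (Function.update ![v, 0] 1 w) = Ω ![v, w]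
  congr 1
  ext i
  fin_cases i <;> rfl

variable [IsTopologicalAddGroup V] [ContinuousSMul ℝ V]
  {W : Type*} [AddCommGroup W] [Module ℝ W] [TopologicalSpace W]
  [IsTopologicalAddGroup W] [ContinuousSMul ℝ W]

variable (V) in
/-- A bivector `π` on a finite-dimensional space `V`, i.e. a skew-symmetric bilinear form on the
dual space, given through the map `π♯ : V* → V`, `μ ↦ π(μ, ·)`. The form itself is
`π(μ, ν) = ⟨ν, π♯ μ⟩`, see `Bivector.pair`. -/
structure Bivector where
  sharp : (V →L[ℝ] ℝ) →L[ℝ] V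
  skew : ∀ μ ν : V →L[ℝ] ℝ, ν (sharp μ) = -μ (sharp ν)

/-- The value `π(μ, ν)` of the skew-symmetric form. -/
def Bivector.pair (π : Bivector V) (μ ν : V →L[ℝ] ℝ) : ℝ := ν (π.sharp μ)

/-- The image of a bivector under a linear map `A`: `(A π)(μ, ν) = π(A* μ, A* ν)`,
so that `(A π)♯ = A ∘ π♯ ∘ A*`. -/
def Bivector.map (A : V →L[ℝ] W) (π : Bivector V) : Bivector W where
  sharp := A ∘L π.sharp ∘L ContinuousLinearMap.precomp ℝ A
  skew μ ν := π.skew (μ ∘L A) (ν ∘L A)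

/-- The graph `Gr(π) = {π♯ μ + μ} ⊆ V ⊕ V*`. -/
def Bivector.graph (π : Bivector V) : Set (V × (V →L[ℝ] ℝ)) :=
  range fun μ => (π.sharp μ, μ)

/-- An alternating form of degree one, seen as a covector. -/
def covector (α : V [⋀^Fin 1]→L[ℝ] ℝ) : V →L[ℝ] ℝ :=
  (ContinuousAlternatingMap.ofSubsingleton ℝ V ℝ (0 : Fin 1)).symm α

/-- The transformation `R_Ω : V ⊕ V* → V ⊕ V*`, `v + μ ↦ v + μ + ι_v Ω`. -/
def gaugeMap (Ω : V [⋀^Fin 2]→L[ℝ] ℝ) (x : V × (V →L[ℝ] ℝ)) : V × (V →L[ℝ] ℝ) :=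
  (x.1, x.2 + contract Ω x.1)

end Linear

/-! ### Differential forms and bivector fields on a manifold -/

section Fields

variable (E : Type*) [NormedAddCommGroup E] [NormedSpace ℝ E]
  (M : Type*) [TopologicalSpace M] [ChartedSpace E M]

/-- Differential forms of degree `n` (no smoothness required yet). -/
abbrev DiffForm (n : ℕ) : Type _ := (x : M) → TangentSpace 𝓘(ℝ, E) x [⋀^Fin n]→L[ℝ] ℝ

/-- Bivector fields (no smoothness required yet). -/
abbrev BivectorField : Type _ := (x : M) → Bivector (TangentSpace 𝓘(ℝ, E) x)

/-- Vector fields (no smoothness required yet). -/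
abbrev VecField : Type _ := (x : M) → TangentSpace 𝓘(ℝ, E) x

variable {E M}

/-- The expression of a differential form in the chart around `x₀`: its pull-back under the
inverse of the chart. Only its values on the target of the chart are meaningful. -/
def DiffForm.inChart {n : ℕ} (Ω : DiffForm E M n) (x₀ : M) (y : E) : E [⋀^Fin n]→L[ℝ] ℝ :=
  (Ω ((extChartAt 𝓘(ℝ, E) x₀).symm y)).compContinuousLinearMap
    (mfderiv 𝓘(ℝ, E) 𝓘(ℝ, E) (extChartAt 𝓘(ℝ, E) x₀).symm y)

/-- The exterior derivative, computed at `x` in the chart around `x`. -/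
def DiffForm.d {n : ℕ} (Ω : DiffForm E M n) : DiffForm E M (n + 1) := fun x =>
  (extDeriv (DiffForm.inChart Ω x) (extChartAt 𝓘(ℝ, E) x x)).compContinuousLinearMap
    (mfderiv 𝓘(ℝ, E) 𝓘(ℝ, E) (extChartAt 𝓘(ℝ, E) x) x)

/-- The expression `y ↦ π♯` of a bivector field in the chart around `x₀`: its push-forward under
the chart. Only its values on the target of the chart are meaningful. -/
def BivectorField.inChart (π : BivectorField E M) (x₀ : M) (y : E) : (E →L[ℝ] ℝ) →L[ℝ] E :=
  ((π ((extChartAt 𝓘(ℝ, E) x₀).symm y)).map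
    (mfderiv 𝓘(ℝ, E) 𝓘(ℝ, E) (extChartAt 𝓘(ℝ, E) x₀)
      ((extChartAt 𝓘(ℝ, E) x₀).symm y)) : Bivector E).sharp

/-- `(Ω_t)`, `t ∈ J`, is a smooth family of differential forms: its coefficients in charts are
smooth functions of `t` and of the point jointly. -/
def SmoothFormFamily {n : ℕ} (J : Set ℝ) (Ω : ℝ → DiffForm E M n) : Prop :=
  ∀ x₀ : M, ContDiffOn ℝ ∞ (fun p : ℝ × E => DiffForm.inChart (Ω p.1) x₀ p.2)
    (J ×ˢ (extChartAt 𝓘(ℝ, E) x₀).target)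

/-- `(π_t)`, `t ∈ J`, is a smooth family of bivector fields: its coefficients in charts are
smooth functions of `t` and of the point jointly. -/
def SmoothBivectorFamily (J : Set ℝ) (π : ℝ → BivectorField E M) : Prop :=
  ∀ x₀ : M, ContDiffOn ℝ ∞ (fun p : ℝ × E => BivectorField.inChart (π p.1) x₀ p.2)
    (J ×ˢ (extChartAt 𝓘(ℝ, E) x₀).target)

/-- The differential of a real function at a point, as a covector. -/
def differential (f : M → ℝ) (x : M) : TangentSpace 𝓘(ℝ, E) x →L[ℝ] ℝ :=
  mfderiv 𝓘(ℝ, E) 𝓘(ℝ, ℝ) f x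

/-- The bracket `{f, g} = π(df, dg)`. -/
def bracket (π : BivectorField E M) (f g : M → ℝ) : M → ℝ := fun x =>
  (π x).pair (differential f x) (differential g x)

/-- The Jacobi identity for the bracket of a (smooth) bivector field `π` on smooth functions:
`π` is a Poisson structure. -/
def IsPoisson (π : BivectorField E M) : Prop :=
  ∀ f g h : M → ℝ, ContMDiff 𝓘(ℝ, E) 𝓘(ℝ, ℝ) ∞ f → ContMDiff 𝓘(ℝ, E) 𝓘(ℝ, ℝ) ∞ g →
    ContMDiff 𝓘(ℝ, E) 𝓘(ℝ, ℝ) ∞ h → ∀ x : M,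
      bracket π f (bracket π g h) x + bracket π g (bracket π h f) x
        + bracket π h (bracket π f g) x = 0

/-- `π' = π^Ω`, that is, `R_Ω(Gr(π)) = Gr(π')`. -/
def IsGaugeTransform (π : BivectorField E M) (Ω : DiffForm E M 2) (π' : BivectorField E M) :
    Prop :=
  ∀ x : M, gaugeMap (Ω x) '' (π x).graph = (π' x).graph

/-- The family `Φ_t : source → target`, `t ∈ J`, of diffeomorphisms between open subsets of `M` is
a (local) flow, starting at time `0`, of the time-dependent vector field `X_t`. The convention is
that `d/dt (Φ_t)_* f = (Φ_t)_* (X_t f)` on functions, where `(Φ_t)_* f = f ∘ Φ_t⁻¹`; so `Φ_t⁻¹(y)`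
is the solution at time `t` of the equation `dx/dt = X_t(x)` with `x(0) = y`. The target of `Φ_t`
is a set of initial values for which the solution exists up to time `t`; a global flow is the case
in which all sources and targets are all of `M`. -/
structure IsLocalFlow (J : Set ℝ) (X : ℝ → VecField E M) (Φ : ℝ → OpenPartialHomeomorph M M) :
    Prop where
  target_subset : ∀ t ∈ J, ∀ s ∈ uIcc 0 t, (Φ t).target ⊆ (Φ s).target
  zero : ∀ y ∈ (Φ 0).target, (Φ 0).symm y = y
  smooth : ∀ t ∈ J, ContMDiffOn 𝓘(ℝ, E) 𝓘(ℝ, E) ∞ (Φ t) (Φ t).source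
  smooth_symm : ContMDiffOn (𝓘(ℝ, ℝ).prod 𝓘(ℝ, E)) 𝓘(ℝ, E) ∞
    (fun p : ℝ × M => (Φ p.1).symm p.2) {p | p.1 ∈ J ∧ p.2 ∈ (Φ p.1).target}
  deriv : ∀ f : M → ℝ, ContMDiff 𝓘(ℝ, E) 𝓘(ℝ, ℝ) ∞ f → ∀ t ∈ J, ∀ y ∈ (Φ t).target,
    HasDerivWithinAt (fun s => f ((Φ s).symm y))
      (differential f ((Φ t).symm y) (X t ((Φ t).symm y)))
      {s | s ∈ J ∧ y ∈ (Φ s).target} t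

/-- `Φ_* π = π'`, where `Φ` is a diffeomorphism between open subsets of `M`, `Φ_* π = (TΦ)(π)`, and
the equality is one of bivector fields on the target of `Φ`. -/
def PushForwardEq (Φ : OpenPartialHomeomorph M M) (π π' : BivectorField E M) : Prop :=
  ∀ x ∈ Φ.source, (π x).map (mfderiv 𝓘(ℝ, E) 𝓘(ℝ, E) Φ x) = π' (Φ x)

end Fields

end PoissonMoser

end

/-!
Differentiating the gauge relation `π_t♯ (ν + ι_{π_0♯ ν} ω_t) = π_0♯ ν` in `t` gives
`∂π_t/∂t (μ) = π_t♯ (ι_{π_t♯ μ} da_t)`. By the Jacobi identity the right-hand side is `-L_{X_t} π_t`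
for `X_t = π_t♯(a_t)`. In fixed charts around `y` and `Φ_t⁻¹(y)`, let `B_s` be the derivative of
`Φ_s⁻¹` at `y` and `p_s` the value of `π_s` at `Φ_s⁻¹(y)`, and let `A` be the derivative of `X_t`.
Then `∂B/∂s = A B` by the variational equation and `∂p/∂s = A p + p A*` by the transport equation,
at `s = t`, so that `B_s⁻¹ p_s B_s⁻¹*`, which represents `(Φ_s)_* π_s` at `y`, has zero derivative
there. Its value at `s = 0` is `π_0` at `y`.
-/

open Filter Topology

noncomputable section

namespace PoissonMoser

section Calculus

variable {E F : Type*} [NormedAddCommGroup E] [NormedSpace ℝ E] [NormedAddCommGroup F]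
  [NormedSpace ℝ F] {I : Set ℝ} {s₀ : ℝ}

theorem hasDerivWithinAt_of_forall_dual [FiniteDimensional ℝ F] {γ : ℝ → F} {v : F}
    (h : ∀ l : F →L[ℝ] ℝ, HasDerivWithinAt (fun s => l (γ s)) (l v) I s₀) :
    HasDerivWithinAt γ v I s₀ := by
  let e := (Module.finBasis ℝ F).equivFunL
  have hcoord : HasDerivWithinAt (fun s => e (γ s)) (e v) I s₀ :=
    hasDerivWithinAt_pi.2 fun i =>
      h (ContinuousLinearMap.proj (R := ℝ) (φ := fun _ => ℝ) i ∘L e.toContinuousLinearMap)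
  simpa [Function.comp_def] using e.symm.hasFDerivAt.comp_hasDerivWithinAt s₀ hcoord

theorem hasDerivWithinAt_of_forall_clm_apply [FiniteDimensional ℝ E] {L : ℝ → E →L[ℝ] F}
    {L' : E →L[ℝ] F} (h : ∀ v, HasDerivWithinAt (fun s => L s v) (L' v) I s₀) :
    HasDerivWithinAt L L' I s₀ := by
  let b := Module.finBasis ℝ E
  let c i : E →L[ℝ] ℝ := (b.coord i).toContinuousLinearMap
  have hsum (A : E →L[ℝ] F) : A = ∑ i, ContinuousLinearMap.smulRightL ℝ E F (c i) (A (b i)) := by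
    ext v
    conv_lhs => rw [← b.sum_repr v, map_sum]
    simp [c]
  rw [hsum L', funext fun s => hsum (L s)]
  exact HasDerivWithinAt.fun_sum fun i _ =>
    (ContinuousLinearMap.smulRightL ℝ E F (c i)).hasFDerivAt.comp_hasDerivWithinAt s₀ (h (b i))

theorem eq_of_hasDerivWithinAt_zero {γ : ℝ → F} (hI : Convex ℝ I)
    (hγ : ∀ s ∈ I, HasDerivWithinAt γ 0 I s) {s t : ℝ} (hs : s ∈ I) (ht : t ∈ I) : γ s = γ t := by
  have := hI.norm_image_sub_le_of_norm_hasDerivWithin_le (C := 0) hγ (by simp) ht hs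
  rwa [zero_mul, norm_le_zero_iff, sub_eq_zero] at this

variable {V : Set E} {z₀ : E} {ψ : ℝ × E → F}

theorem hasFDerivAt_prodMk_of_hasFDerivWithinAt {L : ℝ × E →L[ℝ] F} (hs₀ : s₀ ∈ I)
    (hV : V ∈ 𝓝 z₀) (hψ : HasFDerivWithinAt ψ L (I ×ˢ V) (s₀, z₀)) :
    HasFDerivAt (fun z => ψ (s₀, z)) (L ∘L .inr ℝ ℝ E) z₀ :=
  (hψ.comp z₀ (hasFDerivAt_prodMk_right s₀ z₀).hasFDerivWithinAt
    (fun _ hz => mk_mem_prod hs₀ hz)).hasFDerivAt hV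

theorem differentiableAt_prodMk_of_differentiableWithinAt (hs₀ : s₀ ∈ I) (hV : V ∈ 𝓝 z₀)
    (hψ : DifferentiableWithinAt ℝ ψ (I ×ˢ V) (s₀, z₀)) :
    DifferentiableAt ℝ (fun z => ψ (s₀, z)) z₀ :=
  (hasFDerivAt_prodMk_of_hasFDerivWithinAt hs₀ hV hψ.hasFDerivWithinAt).differentiableAt

theorem hasDerivWithinAt_comp_curve {L : ℝ × E →L[ℝ] F} {γ : ℝ → E} {v : E}
    (hψ : HasFDerivWithinAt ψ L (I ×ˢ V) (s₀, γ s₀)) (hγ : HasDerivWithinAt γ v I s₀)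
    (hγV : ∀ᶠ s in 𝓝[I] s₀, γ s ∈ V) :
    HasDerivWithinAt (fun s => ψ (s, γ s)) (L (1, v)) I s₀ :=
  (hψ.comp_hasDerivWithinAt s₀
    (((hasDerivWithinAt_id s₀ I).prodMk hγ).mono (inter_subset_left (t := γ ⁻¹' V)))
    fun _ hs => mk_mem_prod hs.1 hs.2).mono_of_mem_nhdsWithin
      (inter_mem self_mem_nhdsWithin hγV)

theorem hasDerivWithinAt_comp_curve_of_partial {γ : ℝ → E} {v : E} {ψ' : F}
    (hs₀ : s₀ ∈ I) (hI : UniqueDiffWithinAt ℝ I s₀) (hV : V ∈ 𝓝 (γ s₀))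
    (hψ : DifferentiableWithinAt ℝ ψ (I ×ˢ V) (s₀, γ s₀))
    (htime : HasDerivWithinAt (fun s => ψ (s, γ s₀)) ψ' I s₀)
    (hγ : HasDerivWithinAt γ v I s₀) (hγV : ∀ᶠ s in 𝓝[I] s₀, γ s ∈ V) :
    HasDerivWithinAt (fun s => ψ (s, γ s))
      (ψ' + fderiv ℝ (fun z => ψ (s₀, z)) (γ s₀) v) I s₀ := by
  obtain ⟨L, hL⟩ := hψ
  have hspace := hasFDerivAt_prodMk_of_hasFDerivWithinAt hs₀ hV hL
  have htime' : HasDerivWithinAt (fun s => ψ (s, γ s₀)) (L (1, 0)) I s₀ :=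
    hasDerivWithinAt_comp_curve (γ := fun _ => γ s₀) hL (hasDerivWithinAt_const ..)
      (.of_forall fun _ => mem_of_mem_nhds hV)
  refine (hasDerivWithinAt_comp_curve hL hγ hγV).congr_deriv ?_
  rw [hspace.fderiv, hI.eq_deriv _ htime htime', ContinuousLinearMap.comp_apply,
    ContinuousLinearMap.inr_apply, ← map_add, Prod.mk_add_mk, add_zero, zero_add]

theorem hasDerivWithinAt_fderiv_prodMk (hI : UniqueDiffOn ℝ I) (hs₀ : s₀ ∈ I)
    (hs₀' : s₀ ∈ closure (interior I)) (hV : IsOpen V) (hz₀ : z₀ ∈ V)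
    (hψ : ContDiffWithinAt ℝ 2 ψ (I ×ˢ V) (s₀, z₀)) :
    HasDerivWithinAt (fun s => fderiv ℝ (fun z => ψ (s, z)) z₀)
      (fderiv ℝ (fun z => derivWithin (fun s => ψ (s, z)) I s₀) z₀) I s₀ := by
  have hmem : (s₀, z₀) ∈ I ×ˢ V := mk_mem_prod hs₀ hz₀
  have hmem' : (s₀, z₀) ∈ closure (interior (I ×ˢ V)) := by
    rw [interior_prod_eq, hV.interior_eq, closure_prod_eq]
    exact ⟨hs₀', subset_closure hz₀⟩
  have hS : UniqueDiffOn ℝ (I ×ˢ V) := hI.prod hV.uniqueDiffOn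
  set D := fderivWithin ℝ ψ (I ×ˢ V)
  obtain ⟨D₂, hD₂⟩ : DifferentiableWithinAt ℝ D (I ×ˢ V) (s₀, z₀) :=
    (hψ.fderivWithin_right hS (m := 1) (by norm_num) hmem).differentiableWithinAt one_ne_zero
  have hD : ∀ᶠ p in 𝓝[I ×ˢ V] (s₀, z₀), HasFDerivWithinAt ψ (D p) (I ×ˢ V) p := by
    have := hψ.eventually (by simp)
    rw [insert_eq_of_mem hmem] at this
    exact this.mono fun p hp => (hp.differentiableWithinAt two_ne_zero).hasFDerivWithinAt
  rw [nhdsWithin_prod_eq, hV.nhdsWithin_eq hz₀] at hD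
  have htime : (fun z => derivWithin (fun s => ψ (s, z)) I s₀) =ᶠ[𝓝 z₀]
      fun z => D (s₀, z) (1, 0) := by
    filter_upwards [((tendsto_const_nhdsWithin hs₀).prodMk tendsto_id).eventually hD,
      hV.mem_nhds hz₀] with z hz hzV
    exact (hasDerivWithinAt_comp_curve (γ := fun _ => z) hz (hasDerivWithinAt_const ..)
      (.of_forall fun _ => hzV)).derivWithin (hI s₀ hs₀)
  have hspace : (fun s => fderiv ℝ (fun z => ψ (s, z)) z₀) =ᶠ[𝓝[I] s₀]
      fun s => D (s, z₀) ∘L .inr ℝ ℝ E := by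
    filter_upwards [(tendsto_id.prodMk tendsto_const_nhds).eventually hD,
      self_mem_nhdsWithin] with s hs hsI
    exact (hasFDerivAt_prodMk_of_hasFDerivWithinAt hsI (hV.mem_nhds hz₀) hs).fderiv
  have hright := (hasFDerivAt_prodMk_of_hasFDerivWithinAt hs₀ (hV.mem_nhds hz₀) hD₂).clm_apply
    (hasFDerivAt_const ((1 : ℝ), (0 : E)) z₀)
  have hleft := (hasDerivWithinAt_comp_curve (γ := fun _ => z₀) hD₂ (hasDerivWithinAt_const ..)
    (.of_forall fun _ => hz₀)).clm_comp
      (hasDerivWithinAt_const s₀ I (ContinuousLinearMap.inr ℝ ℝ E))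
  have hsymm : IsSymmSndFDerivWithinAt ℝ ψ (I ×ˢ V) (s₀, z₀) :=
    hψ.isSymmSndFDerivWithinAt (by simp) hS hmem' hmem
  refine (hleft.congr_of_eventuallyEq hspace (hspace.self_of_nhdsWithin hs₀)).congr_deriv ?_
  rw [htime.fderiv_eq, hright.fderiv]
  ext w
  have := hsymm (1, 0) (0, w)
  rw [hD₂.fderivWithin (hS _ hmem)] at this
  simpa using this

theorem hasDerivWithinAt_fderiv_flow {ψ : ℝ × E → E} {X : E → E} (hI : UniqueDiffOn ℝ I)
    (hs₀ : s₀ ∈ I) (hs₀' : s₀ ∈ closure (interior I)) (hV : IsOpen V) (hz₀ : z₀ ∈ V)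
    (hψ : ContDiffWithinAt ℝ 2 ψ (I ×ˢ V) (s₀, z₀)) (hX : DifferentiableAt ℝ X (ψ (s₀, z₀)))
    (hflow : ∀ᶠ z in 𝓝 z₀, HasDerivWithinAt (fun s => ψ (s, z)) (X (ψ (s₀, z))) I s₀) :
    HasDerivWithinAt (fun s => fderiv ℝ (fun z => ψ (s, z)) z₀)
      (fderiv ℝ X (ψ (s₀, z₀)) ∘L fderiv ℝ (fun z => ψ (s₀, z)) z₀) I s₀ := by
  have htime : (fun z => derivWithin (fun s => ψ (s, z)) I s₀) =ᶠ[𝓝 z₀]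
      fun z => X (ψ (s₀, z)) :=
    hflow.mono fun z hz => hz.derivWithin (hI s₀ hs₀)
  have hspace : DifferentiableAt ℝ (fun z => ψ (s₀, z)) z₀ :=
    differentiableAt_prodMk_of_differentiableWithinAt hs₀ (hV.mem_nhds hz₀)
      (hψ.differentiableWithinAt two_ne_zero)
  exact (hasDerivWithinAt_fderiv_prodMk hI hs₀ hs₀' hV hz₀ hψ).congr_deriv
    (htime.fderiv_eq.trans (fderiv_comp z₀ hX hspace))

end Calculus

section Transport

variable {E : Type*} [NormedAddCommGroup E] [NormedSpace ℝ E] {I : Set ℝ} {s₀ : ℝ}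

theorem hasDerivWithinAt_clm_inverse [CompleteSpace E] {B : ℝ → E →L[ℝ] E} {B' : E →L[ℝ] E}
    (hB : HasDerivWithinAt B B' I s₀) (hinv : (B s₀).IsInvertible) :
    HasDerivWithinAt (fun s => (B s).inverse) (-((B s₀).inverse ∘L B' ∘L (B s₀).inverse)) I s₀ := by
  obtain ⟨e, he⟩ := hinv
  let u : (E →L[ℝ] E)ˣ := ContinuousLinearEquiv.unitsEquiv ℝ E |>.symm e
  have hu : B s₀ = u := he.symm
  have hR : HasFDerivAt Ring.inverse _ (B s₀) := hu ▸ hasFDerivAt_ringInverse (𝕜 := ℝ) u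
  have := hR.comp_hasDerivWithinAt s₀ hB
  simp only [Function.comp_def, ContinuousLinearMap.ringInverse_eq_inverse] at this
  refine this.congr_deriv ?_
  rw [← ContinuousLinearMap.ringInverse_eq_inverse, hu, Ring.inverse_unit]
  rfl

theorem hasDerivWithinAt_precomp {C : ℝ → E →L[ℝ] E} {C' : E →L[ℝ] E}
    (hC : HasDerivWithinAt C C' I s₀) :
    HasDerivWithinAt (fun s => (.precomp ℝ (C s) : (E →L[ℝ] ℝ) →L[ℝ] E →L[ℝ] ℝ))
      (.precomp ℝ C') I s₀ :=
  HasFDerivAt.comp_hasDerivWithinAt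
    (l := fun C : E →L[ℝ] E => (.precomp ℝ C : (E →L[ℝ] ℝ) →L[ℝ] E →L[ℝ] ℝ)) s₀
    (ContinuousLinearMap.compL ℝ E E ℝ).flip.hasFDerivAt hC

theorem hasDerivWithinAt_comp_comp_precomp {C : ℝ → E →L[ℝ] E} {C' : E →L[ℝ] E}
    {p : ℝ → (E →L[ℝ] ℝ) →L[ℝ] E} {p' : (E →L[ℝ] ℝ) →L[ℝ] E}
    (hC : HasDerivWithinAt C C' I s₀) (hp : HasDerivWithinAt p p' I s₀) :
    HasDerivWithinAt (fun s => C s ∘L p s ∘L .precomp ℝ (C s))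
      (C' ∘L p s₀ ∘L .precomp ℝ (C s₀)
        + C s₀ ∘L (p' ∘L .precomp ℝ (C s₀) + p s₀ ∘L .precomp ℝ C')) I s₀ :=
  hC.clm_comp (hp.clm_comp (hasDerivWithinAt_precomp hC))

theorem hasDerivWithinAt_conj_inverse_eq_zero [CompleteSpace E] {B : ℝ → E →L[ℝ] E}
    {A : E →L[ℝ] E} {p : ℝ → (E →L[ℝ] ℝ) →L[ℝ] E} (hinv : (B s₀).IsInvertible)
    (hB : HasDerivWithinAt B (A ∘L B s₀) I s₀)
    (hp : HasDerivWithinAt p (A ∘L p s₀ + p s₀ ∘L .precomp ℝ A) I s₀) :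
    HasDerivWithinAt (fun s => (B s).inverse ∘L p s ∘L .precomp ℝ (B s).inverse) 0 I s₀ := by
  have hC : HasDerivWithinAt (fun s => (B s).inverse) (-((B s₀).inverse ∘L A)) I s₀ := by
    refine (hasDerivWithinAt_clm_inverse hB hinv).congr_deriv ?_
    rw [ContinuousLinearMap.comp_assoc, hinv.self_comp_inverse, ContinuousLinearMap.comp_id]
  convert hasDerivWithinAt_comp_comp_precomp hC hp using 1
  ext μ
  have hμ : μ ∘L (-((B s₀).inverse ∘L A)) = -((μ ∘L (B s₀).inverse) ∘L A) := by ext; simp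
  simp [hμ]

end Transport

section LieDerivative

variable {E : Type*} [NormedAddCommGroup E] [NormedSpace ℝ E]

theorem hasDerivWithinAt_gaugeTransform [FiniteDimensional ℝ E] {I : Set ℝ} {s₀ : ℝ} (hs₀ : s₀ ∈ I)
    (hI : UniqueDiffWithinAt ℝ I s₀) {π₀ : Bivector E} {π : ℝ → Bivector E}
    {Ω : ℝ → E [⋀^Fin 2]→L[ℝ] ℝ} {Ω' : E [⋀^Fin 2]→L[ℝ] ℝ} {π' : (E →L[ℝ] ℝ) →L[ℝ] E}
    (hgauge : ∀ s ∈ I, gaugeMap (Ω s) '' π₀.graph = (π s).graph)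
    (hΩ : ∀ v, HasDerivWithinAt (fun s => Ω s v) (-Ω' v) I s₀)
    (hπ : HasDerivWithinAt (fun s => (π s).sharp) π' I s₀) (μ : E →L[ℝ] ℝ) :
    π' μ = (π s₀).sharp (contract Ω' ((π s₀).sharp μ)) := by
  have hsharp : ∀ s ∈ I, ∀ ν, (π s).sharp (ν + contract (Ω s) (π₀.sharp ν)) = π₀.sharp ν := by
    intro s hs ν
    obtain ⟨κ, hκ⟩ := hgauge s hs ▸ mem_image_of_mem _ (mem_range_self ν)
    obtain ⟨hκ₁, hκ₂⟩ := Prod.mk.inj hκ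
    exact hκ₂ ▸ hκ₁
  obtain ⟨_, ⟨ν, rfl⟩, hν⟩ : ((π s₀).sharp μ, μ) ∈ gaugeMap (Ω s₀) '' π₀.graph :=
    hgauge s₀ hs₀ ▸ mem_range_self μ
  obtain ⟨hν₁, hν₂⟩ : π₀.sharp ν = (π s₀).sharp μ ∧ ν + contract (Ω s₀) (π₀.sharp ν) = μ :=
    Prod.mk.inj hν
  have hcov : HasDerivWithinAt (fun s => ν + contract (Ω s) (π₀.sharp ν))
      (-contract Ω' (π₀.sharp ν)) I s₀ := by
    refine .const_add ν (hasDerivWithinAt_of_forall_clm_apply fun w => ?_)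
    simpa only [contract_apply, neg_apply] using hΩ ![π₀.sharp ν, w]
  have hconst : HasDerivWithinAt (fun s => (π s).sharp (ν + contract (Ω s) (π₀.sharp ν))) 0 I s₀ :=
    (hasDerivWithinAt_const s₀ I (π₀.sharp ν)).congr_of_mem (fun s hs => hsharp s hs ν) hs₀
  have := hI.eq_deriv _ (hπ.clm_apply hcov) hconst
  rw [hν₂, hν₁, map_neg] at this
  exact add_neg_eq_zero.1 this

/-- The Lie derivative `L_X P` at `x` of a bivector field on `E`, given like `Bivector` through
the maps `P z = π_z♯`. -/
def lieDerivBivector (X : E → E) (P : E → (E →L[ℝ] ℝ) →L[ℝ] E) (x : E) :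
    (E →L[ℝ] ℝ) →L[ℝ] E :=
  fderiv ℝ P x (X x) - fderiv ℝ X x ∘L P x - P x ∘L .precomp ℝ (fderiv ℝ X x)

/-- The Jacobi identity at `x`, on linear coordinate functions `l`, `μ`, `ν`, for the bracket of
the bivector field on `E` given through the maps `P z = π_z♯`; equivalently, the Schouten bracket
`[π, π]` vanishes at `x`. -/
def JacobiAt (P : E → (E →L[ℝ] ℝ) →L[ℝ] E) (x : E) : Prop :=
  ∀ l μ ν : E →L[ℝ] ℝ,
    ν (fderiv ℝ P x (P x l) μ) + l (fderiv ℝ P x (P x μ) ν) + μ (fderiv ℝ P x (P x ν) l) = 0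

theorem fderiv_skew {P : E → (E →L[ℝ] ℝ) →L[ℝ] E} {x : E}
    (hskew : ∀ z (μ ν : E →L[ℝ] ℝ), ν (P z μ) = -μ (P z ν)) (hP : DifferentiableAt ℝ P x) (v : E)
    (μ ν : E →L[ℝ] ℝ) : ν (fderiv ℝ P x v μ) = -μ (fderiv ℝ P x v ν) := by
  have hpair (μ ν : E →L[ℝ] ℝ) : HasFDerivAt (fun z => ν (P z μ)) _ x :=
    ν.hasFDerivAt.comp x (hP.hasFDerivAt.clm_apply (hasFDerivAt_const μ x))
  have := (hpair μ ν).unique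
    ((hpair ν μ).neg.congr_of_eventuallyEq (.of_forall fun z => hskew z μ ν))
  simpa using DFunLike.congr_fun this v

theorem covector_apply {V : Type*} [AddCommGroup V] [Module ℝ V] [TopologicalSpace V]
    (α : V [⋀^Fin 1]→L[ℝ] ℝ) (v : V) : covector α v = α ![v] := by
  change α (fun _ => v) = α ![v]
  congr 1
  ext i
  fin_cases i
  rfl

theorem differentiableAt_covector {α : E → E [⋀^Fin 1]→L[ℝ] ℝ} {x : E} :
    DifferentiableAt ℝ (fun z => covector (α z)) x ↔ DifferentiableAt ℝ α x :=
  (ContinuousAlternatingMap.ofSubsingletonLIE (𝕜 := ℝ) (E := E) (F := ℝ)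
    (0 : Fin 1)).symm.comp_differentiableAt_iff

theorem fderiv_covector_apply (α : E → E [⋀^Fin 1]→L[ℝ] ℝ) (x v w : E) :
    fderiv ℝ (fun z => covector (α z)) x v w = fderiv ℝ α x v ![w] := by
  have := (ContinuousAlternatingMap.ofSubsingletonLIE (𝕜 := ℝ) (E := E) (F := ℝ)
    (0 : Fin 1)).symm.comp_fderiv (f := α) (x := x)
  exact (congrArg (· v w) this).trans (covector_apply (fderiv ℝ α x v) w)

theorem contract_extDeriv_apply (α : E → E [⋀^Fin 1]→L[ℝ] ℝ) (x v w : E) :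
    contract (extDeriv α x) v w = fderiv ℝ (fun z => covector (α z)) x v w
      - fderiv ℝ (fun z => covector (α z)) x w v := by
  have h₀ : (0 : Fin 2).removeNth ![v, w] = ![w] := by ext i; fin_cases i; rfl
  have h₁ : (1 : Fin 2).removeNth ![v, w] = ![v] := by ext i; fin_cases i; rfl
  rw [contract_apply, extDeriv, ContinuousAlternatingMap.alternatizeUncurryFin_apply,
    Fin.sum_univ_two, h₀, h₁, fderiv_covector_apply, fderiv_covector_apply]
  simp [sub_eq_add_neg]

-- By the Jacobi identity, all terms in which `α` is not differentiated cancel.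
theorem lieDerivBivector_sharp_apply {P : E → (E →L[ℝ] ℝ) →L[ℝ] E} {α : E → E [⋀^Fin 1]→L[ℝ] ℝ}
    {x : E} (hskew : ∀ z (μ ν : E →L[ℝ] ℝ), ν (P z μ) = -μ (P z ν))
    (hP : DifferentiableAt ℝ P x) (hJacobi : JacobiAt P x) (hα : DifferentiableAt ℝ α x)
    (μ : E →L[ℝ] ℝ) :
    lieDerivBivector (fun z => P z (covector (α z))) P x μ
      = -P x (contract (extDeriv α x) (P x μ)) := by
  obtain ⟨Dα, hDα⟩ : ∃ D, D = fderiv ℝ (fun z => covector (α z)) x := ⟨_, rfl⟩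
  have hX (v : E) : fderiv ℝ (fun z => P z (covector (α z))) x v
      = fderiv ℝ P x v (covector (α x)) + P x (Dα v) := by
    rw [(hP.hasFDerivAt.clm_apply (differentiableAt_covector.2 hα).hasFDerivAt).fderiv, hDα]
    simp [add_comm]
  have hdα (v w : E) : contract (extDeriv α x) v w = Dα v w - Dα w v :=
    hDα ▸ contract_extDeriv_apply α x v w
  rw [lieDerivBivector]
  generalize fderiv ℝ (fun z => P z (covector (α z))) x = A at hX ⊢
  refine (SeparatingDual.eq_iff_forall_dual_eq (R := ℝ)).2 fun ν => ?_
  have hPA : ν (P x (μ ∘L A)) = -μ (A (P x ν)) := hskew x (μ ∘L A) ν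
  have hPdα := hskew x (contract (extDeriv α x) (P x μ)) ν
  have hPDα := hskew x (Dα (P x μ)) ν
  have hPDα' := hskew x (Dα (P x ν)) μ
  have hJ := hJacobi (covector (α x)) μ ν
  have hDP := fderiv_skew hskew hP (P x μ) (covector (α x)) ν
  rw [hX, map_add] at hPA
  rw [hdα] at hPdα
  simp only [sub_apply, ContinuousLinearMap.comp_apply, ContinuousLinearMap.precomp_apply, hX,
    map_add, map_sub, map_neg]
  linarith

theorem lieDerivBivector_congr {X Y : E → E} {x : E} (h : X =ᶠ[𝓝 x] Y)
    (P : E → (E →L[ℝ] ℝ) →L[ℝ] E) : lieDerivBivector X P x = lieDerivBivector Y P x := by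
  rw [lieDerivBivector, lieDerivBivector, h.fderiv_eq, h.self_of_nhds]

theorem hasDerivWithinAt_comp_curve_of_lieDerivBivector {I : Set ℝ} {s₀ : ℝ} (hs₀ : s₀ ∈ I)
    (hI : UniqueDiffWithinAt ℝ I s₀) {V : Set E} {P : ℝ × E → (E →L[ℝ] ℝ) →L[ℝ] E} {X : E → E}
    {γ : ℝ → E} {x : E} (hγ₀ : γ s₀ = x) (hV : V ∈ 𝓝 x)
    (hP : DifferentiableWithinAt ℝ P (I ×ˢ V) (s₀, x))
    (htime : HasDerivWithinAt (fun s => P (s, x)) (-lieDerivBivector X (fun z => P (s₀, z)) x) I s₀)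
    (hγ : HasDerivWithinAt γ (X x) I s₀) (hγV : ∀ᶠ s in 𝓝[I] s₀, γ s ∈ V) :
    HasDerivWithinAt (fun s => P (s, γ s))
      (fderiv ℝ X x ∘L P (s₀, x) + P (s₀, x) ∘L .precomp ℝ (fderiv ℝ X x)) I s₀ := by
  subst hγ₀
  refine (hasDerivWithinAt_comp_curve_of_partial (F := (E →L[ℝ] ℝ) →L[ℝ] E)
    hs₀ hI hV hP htime hγ hγV).congr_deriv ?_
  rw [lieDerivBivector]
  abel

end LieDerivative

attribute [ext] Bivector

section Charts

variable {E : Type*} [NormedAddCommGroup E] [NormedSpace ℝ E]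
  {M : Type*} [TopologicalSpace M] [ChartedSpace E M]
  {N : Type*} [TopologicalSpace N] [ChartedSpace E N]
  {N' : Type*} [TopologicalSpace N'] [ChartedSpace E N']

/-- The push-forward `(TF)(π)` at `F x` of the bivector `π x`, as a map from covectors to vectors.
All tangent spaces are identified with `E`, so that these maps can be differentiated in `x`. -/
def BivectorField.pushSharp (π : BivectorField E M) (F : M → N) (x : M) :
    (E →L[ℝ] ℝ) →L[ℝ] E :=
  ((π x).map (W := E) (mfderiv 𝓘(ℝ, E) 𝓘(ℝ, E) F x)).sharp

theorem BivectorField.pushSharp_congr (π : BivectorField E M) {F G : M → N} {x : M}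
    (h : F =ᶠ[𝓝 x] G) : π.pushSharp F x = π.pushSharp G x := by
  rw [pushSharp, pushSharp, h.mfderiv_eq]
  rfl

theorem BivectorField.pushSharp_eq_comp (π : BivectorField E M) {F : M → N} {G : M → N'} {x : M}
    {L : E →L[ℝ] E}
    (h : (mfderiv 𝓘(ℝ, E) 𝓘(ℝ, E) G x : E →L[ℝ] E) = L ∘L mfderiv 𝓘(ℝ, E) 𝓘(ℝ, E) F x) :
    π.pushSharp G x = L ∘L π.pushSharp F x ∘L .precomp ℝ L := by
  rw [pushSharp, h]
  rfl

theorem BivectorField.pushSharp_id (π : BivectorField E M) (x : M) :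
    π.pushSharp id x = (π x).sharp := by
  rw [pushSharp, mfderiv_id]
  rfl

theorem BivectorField.inChart_extChartAt (π : BivectorField E M) {c x : M}
    (hx : x ∈ (extChartAt 𝓘(ℝ, E) c).source) :
    π.inChart c (extChartAt 𝓘(ℝ, E) c x) = π.pushSharp (extChartAt 𝓘(ℝ, E) c) x :=
  congrArg (π.pushSharp (extChartAt 𝓘(ℝ, E) c)) ((extChartAt 𝓘(ℝ, E) c).left_inv hx)

theorem BivectorField.inChart_skew (π : BivectorField E M) (c : M) (z : E) (μ ν : E →L[ℝ] ℝ) :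
    ν (π.inChart c z μ) = -μ (π.inChart c z ν) :=
  Bivector.skew _ μ ν

/-- The expression of a vector field in the chart around `x₀`: its push-forward under the chart.
Only its values on the target of the chart are meaningful. -/
def VecField.inChart (X : VecField E M) (x₀ : M) (y : E) : E :=
  mfderiv 𝓘(ℝ, E) 𝓘(ℝ, E) (extChartAt 𝓘(ℝ, E) x₀) ((extChartAt 𝓘(ℝ, E) x₀).symm y)
    (X ((extChartAt 𝓘(ℝ, E) x₀).symm y))

theorem VecField.inChart_extChartAt (X : VecField E M) {c x : M}
    (hx : x ∈ (extChartAt 𝓘(ℝ, E) c).source) :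
    VecField.inChart X c (extChartAt 𝓘(ℝ, E) c x)
      = mfderiv 𝓘(ℝ, E) 𝓘(ℝ, E) (extChartAt 𝓘(ℝ, E) c) x (X x) :=
  congrArg (fun x => (mfderiv 𝓘(ℝ, E) 𝓘(ℝ, E) (extChartAt 𝓘(ℝ, E) c) x (X x) : E))
    ((extChartAt 𝓘(ℝ, E) c).left_inv hx)

/-- The vector field `π♯(a)`. -/
def BivectorField.sharpField (π : BivectorField E M) (a : DiffForm E M 1) : VecField E M :=
  fun x => (π x).sharp (covector (a x))

section IsManifoldOne

variable [IsManifold 𝓘(ℝ, E) 1 M]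

theorem BivectorField.inChart_self (π : BivectorField E M) (c : M) :
    π.inChart c (extChartAt 𝓘(ℝ, E) c c) = (π c).sharp := by
  rw [π.inChart_extChartAt (mem_extChartAt_source c), pushSharp, mfderiv_extChartAt_self]
  rfl

theorem DiffForm.d_self {n : ℕ} (Ω : DiffForm E M n) (c : M) :
    Ω.d c = extDeriv (Ω.inChart c) (extChartAt 𝓘(ℝ, E) c c) := by
  rw [DiffForm.d, mfderiv_extChartAt_self]
  rfl

theorem BivectorField.inChart_sharpField (π : BivectorField E M) (a : DiffForm E M 1) {c : M}
    {z : E} (hz : z ∈ (extChartAt 𝓘(ℝ, E) c).target) :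
    (π.sharpField a).inChart c z = π.inChart c z (covector (a.inChart c z)) := by
  have hinv := mfderivWithin_extChartAt_symm_comp_mfderiv_extChartAt (I := 𝓘(ℝ, E)) hz
  rw [ModelWithCorners.range_eq_univ, mfderivWithin_univ] at hinv
  have hcov : covector (a.inChart c z) ∘L (mfderiv 𝓘(ℝ, E) 𝓘(ℝ, E) (extChartAt 𝓘(ℝ, E) c)
      ((extChartAt 𝓘(ℝ, E) c).symm z)) = covector (a ((extChartAt 𝓘(ℝ, E) c).symm z)) := by
    ext v
    exact congrArg (covector (a ((extChartAt 𝓘(ℝ, E) c).symm z))) (DFunLike.congr_fun hinv v)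
  exact congrArg (fun μ => mfderiv 𝓘(ℝ, E) 𝓘(ℝ, E) (extChartAt 𝓘(ℝ, E) c)
    ((extChartAt 𝓘(ℝ, E) c).symm z) ((π _).sharp μ)) hcov.symm

end IsManifoldOne

theorem bracket_congr (π : BivectorField E M) {f f' g g' : M → ℝ} {x : M} (hf : f =ᶠ[𝓝 x] f')
    (hg : g =ᶠ[𝓝 x] g') : bracket π f g x = bracket π f' g' x := by
  simp only [bracket, differential, hf.mfderiv_eq, hg.mfderiv_eq]

theorem bracket_comp (π : BivectorField E M) {F : M → E} {k₁ k₂ : E → ℝ} {x : M}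
    (hF : MDifferentiableAt 𝓘(ℝ, E) 𝓘(ℝ, E) F x) (hk₁ : DifferentiableAt ℝ k₁ (F x))
    (hk₂ : DifferentiableAt ℝ k₂ (F x)) :
    bracket π (k₁ ∘ F) (k₂ ∘ F) x
      = fderiv ℝ k₂ (F x) (π.pushSharp F x (fderiv ℝ k₁ (F x))) := by
  rw [bracket, differential, differential, mfderiv_comp x hk₁.mdifferentiableAt hF,
    mfderiv_comp x hk₂.mdifferentiableAt hF, mfderiv_eq_fderiv, mfderiv_eq_fderiv]
  rfl

variable [FiniteDimensional ℝ E] [IsManifold 𝓘(ℝ, E) ∞ M] [T2Space M]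

theorem exists_contMDiff_eventuallyEq_extChartAt (c : M) :
    ∃ F : M → E, ContMDiff 𝓘(ℝ, E) 𝓘(ℝ, E) ∞ F ∧ F =ᶠ[𝓝 c] extChartAt 𝓘(ℝ, E) c := by
  obtain ⟨β⟩ : Nonempty (SmoothBumpFunction 𝓘(ℝ, E) c) := inferInstance
  refine ⟨fun x => β x • extChartAt 𝓘(ℝ, E) c x,
    β.contMDiff_smul (contMDiffOn_extChartAt (n := ∞)), ?_⟩
  filter_upwards [β.eventuallyEq_one] with x hx
  rw [hx, Pi.one_apply, one_smul]

theorem IsPoisson.jacobiAt_inChart {π : BivectorField E M} (hπ : IsPoisson π) {c : M}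
    (hd : DifferentiableAt ℝ (π.inChart c) (extChartAt 𝓘(ℝ, E) c c)) :
    JacobiAt (π.inChart c) (extChartAt 𝓘(ℝ, E) c c) := by
  obtain ⟨F, hF, hFc⟩ := exists_contMDiff_eventuallyEq_extChartAt (E := E) c
  have hFd (x : M) : MDifferentiableAt 𝓘(ℝ, E) 𝓘(ℝ, E) F x := (hF x).mdifferentiableAt (by simp)
  have hpush : ∀ᶠ x in 𝓝 c, π.pushSharp F x = π.inChart c (F x) := by
    filter_upwards [hFc.eventuallyEq_nhds, extChartAt_source_mem_nhds (I := 𝓘(ℝ, E)) c]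
      with x hx hxc
    rw [π.pushSharp_congr hx, hx.self_of_nhds, π.inChart_extChartAt hxc]
  have hbracket (μ ν : E →L[ℝ] ℝ) :
      bracket π (μ ∘ F) (ν ∘ F) =ᶠ[𝓝 c] (fun z => ν (π.inChart c z μ)) ∘ F := by
    filter_upwards [hpush] with x hx
    rw [bracket_comp π (hFd x) μ.differentiableAt ν.differentiableAt, hx, μ.fderiv, ν.fderiv,
      Function.comp_apply]
  rw [← hFc.self_of_nhds] at hd ⊢
  have hbracket₂ (l μ ν : E →L[ℝ] ℝ) : bracket π (l ∘ F) (bracket π (μ ∘ F) (ν ∘ F)) c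
      = ν (fderiv ℝ (π.inChart c) (F c) (π.inChart c (F c) l) μ) := by
    have hk : HasFDerivAt (fun z => ν (π.inChart c z μ)) _ (F c) :=
      ν.hasFDerivAt.comp (F c) (hd.hasFDerivAt.clm_apply (hasFDerivAt_const μ (F c)))
    rw [bracket_congr π .rfl (hbracket μ ν),
      bracket_comp π (hFd c) l.differentiableAt hk.differentiableAt, hpush.self_of_nhds, l.fderiv]
    simpa using DFunLike.congr_fun hk.fderiv _
  intro l μ ν
  have hsmooth (l : E →L[ℝ] ℝ) : ContMDiff 𝓘(ℝ, E) 𝓘(ℝ, ℝ) ∞ (l ∘ F) := l.contMDiff.comp hF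
  have := hπ _ _ _ (hsmooth l) (hsmooth μ) (hsmooth ν) c
  rwa [hbracket₂, hbracket₂, hbracket₂] at this

end Charts

section Moser

variable {E : Type*} [NormedAddCommGroup E] [NormedSpace ℝ E]
  {M : Type*} [TopologicalSpace M] [ChartedSpace E M] {J : Set ℝ}

theorem SmoothBivectorFamily.differentiableAt_inChart {π : ℝ → BivectorField E M}
    (hπ : SmoothBivectorFamily J π) {t : ℝ} (ht : t ∈ J) (c : M) :
    DifferentiableAt ℝ ((π t).inChart c) (extChartAt 𝓘(ℝ, E) c c) :=
  differentiableAt_prodMk_of_differentiableWithinAt ht (extChartAt_target_mem_nhds c)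
    ((hπ c).differentiableOn (by simp) _ ⟨ht, mem_extChartAt_target c⟩)

theorem SmoothFormFamily.differentiableAt_inChart {n : ℕ} {a : ℝ → DiffForm E M n}
    (ha : SmoothFormFamily J a) {t : ℝ} (ht : t ∈ J) (c : M) :
    DifferentiableAt ℝ ((a t).inChart c) (extChartAt 𝓘(ℝ, E) c c) :=
  differentiableAt_prodMk_of_differentiableWithinAt ht (extChartAt_target_mem_nhds c)
    ((ha c).differentiableOn (by simp) _ ⟨ht, mem_extChartAt_target c⟩)

/-- The family `π_t`, `t ∈ J`, satisfies `∂π_t/∂t = -L_{X_t} π_t`, the infinitesimal form of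
`(Φ_t)_* π_t = π_0` for the flow `Φ_t` of `X_t`. At `c`, the equation is read in the chart
around `c`. -/
def IsTransportedBy (J : Set ℝ) (X : ℝ → VecField E M) (π : ℝ → BivectorField E M) : Prop :=
  ∀ t ∈ J, ∀ c : M, HasDerivWithinAt (fun s => (π s).inChart c (extChartAt 𝓘(ℝ, E) c c))
    (-lieDerivBivector ((X t).inChart c) ((π t).inChart c) (extChartAt 𝓘(ℝ, E) c c)) J t

theorem inChart_sharpField_eventuallyEq [IsManifold 𝓘(ℝ, E) 1 M] (π : BivectorField E M)
    (a : DiffForm E M 1) (c : M) :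
    (π.sharpField a).inChart c =ᶠ[𝓝 (extChartAt 𝓘(ℝ, E) c c)]
      fun z => π.inChart c z (covector (a.inChart c z)) :=
  eventually_of_mem (extChartAt_target_mem_nhds c) fun _ hz => π.inChart_sharpField a hz

theorem differentiableAt_inChart_sharpField [IsManifold 𝓘(ℝ, E) 1 M] {π : BivectorField E M}
    {a : DiffForm E M 1} {c : M}
    (hπ : DifferentiableAt ℝ (π.inChart c) (extChartAt 𝓘(ℝ, E) c c))
    (ha : DifferentiableAt ℝ (a.inChart c) (extChartAt 𝓘(ℝ, E) c c)) :
    DifferentiableAt ℝ ((π.sharpField a).inChart c) (extChartAt 𝓘(ℝ, E) c c) :=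
  (hπ.clm_apply (differentiableAt_covector.2 ha)).congr_of_eventuallyEq
    (inChart_sharpField_eventuallyEq π a c)

variable [FiniteDimensional ℝ E] [IsManifold 𝓘(ℝ, E) ∞ M] [T2Space M]

theorem IsPoisson.lieDerivBivector_sharpField {π : BivectorField E M} {a : DiffForm E M 1} {c : M}
    (hπ : IsPoisson π) (hπd : DifferentiableAt ℝ (π.inChart c) (extChartAt 𝓘(ℝ, E) c c))
    (had : DifferentiableAt ℝ (a.inChart c) (extChartAt 𝓘(ℝ, E) c c)) (μ : E →L[ℝ] ℝ) :
    lieDerivBivector ((π.sharpField a).inChart c) (π.inChart c) (extChartAt 𝓘(ℝ, E) c c) μ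
      = -(π c).sharp (contract (a.d c) ((π c).sharp μ)) := by
  have : IsManifold 𝓘(ℝ, E) 1 M := .of_le (n := ∞) (by simp)
  rw [lieDerivBivector_congr (inChart_sharpField_eventuallyEq π a c),
    lieDerivBivector_sharp_apply (π.inChart_skew c) hπd (hπ.jacobiAt_inChart hπd) had,
    π.inChart_self, a.d_self]
  rfl

theorem isTransportedBy_sharpField {π₀ : BivectorField E M} {π : ℝ → BivectorField E M}
    {Ω : ℝ → DiffForm E M 2} {a : ℝ → DiffForm E M 1}
    (hπ : SmoothBivectorFamily J π) (ha : SmoothFormFamily J a)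
    (hPoisson : ∀ t ∈ J, IsPoisson (π t)) (hgauge : ∀ t ∈ J, IsGaugeTransform π₀ (Ω t) (π t))
    (hΩ : ∀ t ∈ J, ∀ (x : M) (v : Fin 2 → TangentSpace 𝓘(ℝ, E) x),
      HasDerivWithinAt (fun s => Ω s x v) (-((a t).d x v)) J t) :
    IsTransportedBy J (fun t => (π t).sharpField (a t)) π := by
  intro t ht c
  have : IsManifold 𝓘(ℝ, E) 1 M := .of_le (n := ∞) (by simp)
  by_cases hacc : AccPt t (𝓟 J)
  swap
  · exact HasFDerivWithinAt.of_not_accPt hacc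
  obtain ⟨L, hL⟩ := (hπ c).differentiableOn (by simp)
    (t, extChartAt 𝓘(ℝ, E) c c) ⟨ht, mem_extChartAt_target c⟩
  have hderiv := hasDerivWithinAt_comp_curve (γ := fun _ => extChartAt 𝓘(ℝ, E) c c) hL
    (hasDerivWithinAt_const ..) (.of_forall fun _ => mem_extChartAt_target c)
  refine hderiv.congr_deriv ?_
  ext μ
  simp only [BivectorField.inChart_self] at hderiv
  have hgauge' := hasDerivWithinAt_gaugeTransform (E := E) ht hacc.uniqueDiffWithinAt
    (Ω' := (a t).d c) (fun s hs => hgauge s hs c) (hΩ t ht c) hderiv μ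
  rw [neg_apply, (hPoisson t ht).lieDerivBivector_sharpField (hπ.differentiableAt_inChart ht c)
    (ha.differentiableAt_inChart ht c)]
  exact hgauge'.trans (neg_neg _).symm

end Moser

section Flow

variable {E : Type*} [NormedAddCommGroup E] [NormedSpace ℝ E]
  {M : Type*} [TopologicalSpace M] [ChartedSpace E M]

/-- The inverse of `e`, read in the charts around `y` (in the source) and around `c` (in the
target). The two centres are independent, so that charts can be kept fixed in a family. -/
def symmInCharts (e : OpenPartialHomeomorph M M) (c y : M) (z : E) : E :=
  extChartAt 𝓘(ℝ, E) c (e.symm ((extChartAt 𝓘(ℝ, E) y).symm z))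

theorem symmInCharts_extChartAt (e : OpenPartialHomeomorph M M) (c y : M) :
    symmInCharts e c y (extChartAt 𝓘(ℝ, E) y y) = extChartAt 𝓘(ℝ, E) c (e.symm y) := by
  rw [symmInCharts, extChartAt_to_inv]

section Derivative

variable [IsManifold 𝓘(ℝ, E) 1 M] {e : OpenPartialHomeomorph M M} {c y : M}

theorem fderiv_symmInCharts (he : e.MDifferentiable 𝓘(ℝ, E) 𝓘(ℝ, E)) (hy : y ∈ e.target)
    (hc : e.symm y ∈ (extChartAt 𝓘(ℝ, E) c).source) :
    fderiv ℝ (symmInCharts e c y) (extChartAt 𝓘(ℝ, E) y y)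
      = (mfderiv 𝓘(ℝ, E) 𝓘(ℝ, E) (extChartAt 𝓘(ℝ, E) c) (e.symm y) : E →L[ℝ] E) ∘L
        mfderiv 𝓘(ℝ, E) 𝓘(ℝ, E) e.symm y := by
  have hchart : MDifferentiableAt 𝓘(ℝ, E) 𝓘(ℝ, E) (extChartAt 𝓘(ℝ, E) c) (e.symm y) :=
    mdifferentiableAt_extChartAt (by rwa [extChartAt_source] at hc)
  have hsymm : MDifferentiableAt 𝓘(ℝ, E) 𝓘(ℝ, E) e.symm y := he.mdifferentiableAt_symm hy
  have hcomp := mfderiv_comp y hchart hsymm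
  rwa [(hchart.comp y hsymm).mfderiv, ModelWithCorners.range_eq_univ, fderivWithin_univ] at hcomp

theorem isInvertible_fderiv_symmInCharts (he : e.MDifferentiable 𝓘(ℝ, E) 𝓘(ℝ, E))
    (hy : y ∈ e.target) (hc : e.symm y ∈ (extChartAt 𝓘(ℝ, E) c).source) :
    (fderiv ℝ (symmInCharts e c y) (extChartAt 𝓘(ℝ, E) y y)).IsInvertible := by
  rw [fderiv_symmInCharts he hy hc]
  exact (isInvertible_mfderiv_extChartAt hc).comp ⟨he.symm.mfderiv hy, rfl⟩

theorem BivectorField.pushSharp_eq_conj_inverse (π : BivectorField E M)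
    (he : e.MDifferentiable 𝓘(ℝ, E) 𝓘(ℝ, E)) (hy : y ∈ e.target)
    (hc : e.symm y ∈ (extChartAt 𝓘(ℝ, E) c).source) :
    π.pushSharp e (e.symm y)
      = (fderiv ℝ (symmInCharts e c y) (extChartAt 𝓘(ℝ, E) y y)).inverse ∘L
        π.inChart c (extChartAt 𝓘(ℝ, E) c (e.symm y)) ∘L
        .precomp ℝ (fderiv ℝ (symmInCharts e c y) (extChartAt 𝓘(ℝ, E) y y)).inverse := by
  rw [π.inChart_extChartAt hc]
  refine π.pushSharp_eq_comp (F := extChartAt 𝓘(ℝ, E) c) (G := e) ?_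
  set B := fderiv ℝ (symmInCharts e c y) (extChartAt 𝓘(ℝ, E) y y) with hB
  have hsymm : (mfderiv 𝓘(ℝ, E) 𝓘(ℝ, E) e.symm y : E →L[ℝ] E) ∘L
      (mfderiv 𝓘(ℝ, E) 𝓘(ℝ, E) e (e.symm y) : E →L[ℝ] E) = .id ℝ E := by
    have := he.symm_comp_deriv (e.map_target hy)
    rwa [e.right_inv hy] at this
  have hBe : B ∘L mfderiv 𝓘(ℝ, E) 𝓘(ℝ, E) e (e.symm y)
      = (mfderiv 𝓘(ℝ, E) 𝓘(ℝ, E) (extChartAt 𝓘(ℝ, E) c) (e.symm y) : E →L[ℝ] E) := by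
    rw [hB, fderiv_symmInCharts he hy hc]
    ext v
    exact congrArg (mfderiv 𝓘(ℝ, E) 𝓘(ℝ, E) (extChartAt 𝓘(ℝ, E) c) (e.symm y))
      (DFunLike.congr_fun hsymm v)
  have hBinv : B.inverse ∘L B = .id ℝ E :=
    (isInvertible_fderiv_symmInCharts he hy hc).inverse_comp_self
  ext v
  exact (DFunLike.congr_fun hBinv _).symm.trans (congrArg B.inverse (DFunLike.congr_fun hBe v))

end Derivative

variable {J I : Set ℝ} {X : ℝ → VecField E M} {Φ : ℝ → OpenPartialHomeomorph M M} {V : Set M}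
  {s₀ : ℝ} {y : M}

theorem IsLocalFlow.mdifferentiable (hΦ : IsLocalFlow J X Φ) {s : ℝ} (hs : s ∈ J) :
    (Φ s).MDifferentiable 𝓘(ℝ, E) 𝓘(ℝ, E) := by
  refine ⟨(hΦ.smooth s hs).mdifferentiableOn (by simp), ?_⟩
  have hpair : ContMDiffOn 𝓘(ℝ, E) (𝓘(ℝ, ℝ).prod 𝓘(ℝ, E)) ∞ (fun y : M => (s, y))
      (Φ s).target := (contMDiff_const.prodMk contMDiff_id).contMDiffOn
  exact (hΦ.smooth_symm.comp hpair fun _ hy => ⟨hs, hy⟩).mdifferentiableOn (by simp)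

theorem IsLocalFlow.continuousWithinAt_symm (hΦ : IsLocalFlow J X Φ) (hIJ : I ⊆ J)
    (hy : ∀ s ∈ I, y ∈ (Φ s).target) (hs₀ : s₀ ∈ I) :
    ContinuousWithinAt (fun s => (Φ s).symm y) I s₀ :=
  ContinuousWithinAt.comp (f := fun s : ℝ => (s, y)) (g := fun p : ℝ × M => (Φ p.1).symm p.2)
    (hΦ.smooth_symm (s₀, y) ⟨hIJ hs₀, hy s₀ hs₀⟩).continuousWithinAt
    (continuousWithinAt_id.prodMk continuousWithinAt_const) fun s hs => ⟨hIJ hs, hy s hs⟩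

theorem IsLocalFlow.pushSharp_zero (hΦ : IsLocalFlow J X Φ) (π : BivectorField E M)
    (hy : y ∈ (Φ 0).target) : π.pushSharp (Φ 0) ((Φ 0).symm y) = (π y).sharp := by
  have hid : Φ 0 =ᶠ[𝓝 y] id := by
    filter_upwards [(Φ 0).open_target.mem_nhds hy] with z hz
    have := (Φ 0).right_inv hz
    rwa [hΦ.zero z hz] at this
  rw [hΦ.zero y hy, π.pushSharp_congr hid, π.pushSharp_id]

theorem IsLocalFlow.hasDerivWithinAt_comp_symm [FiniteDimensional ℝ E] (hΦ : IsLocalFlow J X Φ)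
    (hIJ : I ⊆ J) (hy : ∀ s ∈ I, y ∈ (Φ s).target) (hs₀ : s₀ ∈ I) {F : M → E}
    (hF : ContMDiff 𝓘(ℝ, E) 𝓘(ℝ, E) ∞ F) :
    HasDerivWithinAt (fun s => F ((Φ s).symm y))
      (mfderiv 𝓘(ℝ, E) 𝓘(ℝ, E) F ((Φ s₀).symm y) (X s₀ ((Φ s₀).symm y))) I s₀ := by
  refine hasDerivWithinAt_of_forall_dual fun l => ?_
  have hl : (differential (l ∘ F) ((Φ s₀).symm y) : E →L[ℝ] ℝ)
      = l ∘L mfderiv 𝓘(ℝ, E) 𝓘(ℝ, E) F ((Φ s₀).symm y) := by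
    rw [differential, mfderiv_comp _ l.mdifferentiableAt ((hF _).mdifferentiableAt (by simp)),
      mfderiv_eq_fderiv, l.fderiv]
    rfl
  exact ((hΦ.deriv _ (l.contMDiff.comp hF) s₀ (hIJ hs₀) y (hy s₀ hs₀)).mono
    fun s hs => ⟨hIJ hs, hy s hs⟩).congr_deriv (DFunLike.congr_fun hl _)

variable [IsManifold 𝓘(ℝ, E) ∞ M] {c : M}

theorem IsLocalFlow.contDiffWithinAt_symmInCharts (hΦ : IsLocalFlow J X Φ) (hIJ : I ⊆ J)
    (hV : ∀ s ∈ I, V ⊆ (Φ s).target) (hs₀ : s₀ ∈ I) (hy : y ∈ V)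
    (hc : (Φ s₀).symm y ∈ (extChartAt 𝓘(ℝ, E) c).source) :
    ContDiffWithinAt ℝ ∞ (fun p : ℝ × E => symmInCharts (Φ p.1) c y p.2)
      (I ×ˢ ((extChartAt 𝓘(ℝ, E) y).target ∩ (extChartAt 𝓘(ℝ, E) y).symm ⁻¹' V))
      (s₀, extChartAt 𝓘(ℝ, E) y y) := by
  set S := I ×ˢ ((extChartAt 𝓘(ℝ, E) y).target ∩ (extChartAt 𝓘(ℝ, E) y).symm ⁻¹' V)
  have hpair : ContMDiffWithinAt 𝓘(ℝ, ℝ × E) (𝓘(ℝ, ℝ).prod 𝓘(ℝ, E)) ∞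
      (fun p : ℝ × E => (p.1, (extChartAt 𝓘(ℝ, E) y).symm p.2)) S
      (s₀, extChartAt 𝓘(ℝ, E) y y) :=
    contDiff_fst.contMDiff.contMDiffAt.contMDiffWithinAt.prodMk
      ((contMDiffOn_extChartAt_symm y _ (mem_extChartAt_target y)).comp
        (s₀, extChartAt 𝓘(ℝ, E) y y) contDiff_snd.contMDiff.contMDiffAt.contMDiffWithinAt
        fun p hp => hp.2.1)
  have hsymm : ContMDiffWithinAt 𝓘(ℝ, ℝ × E) 𝓘(ℝ, E) ∞
      (fun p : ℝ × E => (Φ p.1).symm ((extChartAt 𝓘(ℝ, E) y).symm p.2)) S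
      (s₀, extChartAt 𝓘(ℝ, E) y y) :=
    ContMDiffWithinAt.comp_of_eq (g := fun p : ℝ × M => (Φ p.1).symm p.2)
      (hΦ.smooth_symm (s₀, y) ⟨hIJ hs₀, hV s₀ hs₀ hy⟩) hpair
      (fun p hp => ⟨hIJ hp.1, hV _ hp.1 hp.2.2⟩) (by rw [extChartAt_to_inv])
  rw [extChartAt_source] at hc
  exact contMDiffWithinAt_iff_contDiffWithinAt.1 <|
    (contMDiffAt_extChartAt' hc).comp_contMDiffWithinAt_of_eq hsymm (by rw [extChartAt_to_inv])

variable [FiniteDimensional ℝ E] [T2Space M]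

theorem IsLocalFlow.eventually_hasDerivWithinAt_symmInCharts (hΦ : IsLocalFlow J X Φ)
    (hIJ : I ⊆ J) (hVo : IsOpen V) (hV : ∀ s ∈ I, V ⊆ (Φ s).target) (hs₀ : s₀ ∈ I) (hy : y ∈ V)
    (hc : (Φ s₀).symm y = c) :
    ∀ᶠ z in 𝓝 (extChartAt 𝓘(ℝ, E) y y),
      HasDerivWithinAt (fun s => symmInCharts (Φ s) c y z)
        ((X s₀).inChart c (symmInCharts (Φ s₀) c y z)) I s₀ := by
  obtain ⟨F, hF, hFc⟩ := exists_contMDiff_eventuallyEq_extChartAt (E := E) c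
  have hsymm : Tendsto (Φ s₀).symm (𝓝 y) (𝓝 c) :=
    hc ▸ (Φ s₀).continuousAt_symm (hV s₀ hs₀ hy)
  have hnear : ∀ᶠ w in 𝓝 y, w ∈ V ∧ F =ᶠ[𝓝 ((Φ s₀).symm w)] extChartAt 𝓘(ℝ, E) c ∧
      (Φ s₀).symm w ∈ (extChartAt 𝓘(ℝ, E) c).source :=
    (hVo.eventually_mem hy).and <| hsymm.eventually <|
      hFc.eventuallyEq_nhds.and (extChartAt_source_mem_nhds c)
  have hcont : Tendsto (extChartAt 𝓘(ℝ, E) y).symm (𝓝 (extChartAt 𝓘(ℝ, E) y y)) (𝓝 y) := by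
    simpa only [ContinuousAt, extChartAt_to_inv] using
      continuousAt_extChartAt_symm (I := 𝓘(ℝ, E)) y
  filter_upwards [hcont.eventually hnear] with z ⟨hzV, hzF, hzc⟩
  set w := (extChartAt 𝓘(ℝ, E) y).symm z
  have hwV : ∀ s ∈ I, w ∈ (Φ s).target := fun s hs => hV s hs hzV
  have hFw : ∀ᶠ s in 𝓝[I] s₀, symmInCharts (Φ s) c y z = F ((Φ s).symm w) :=
    (hΦ.continuousWithinAt_symm hIJ hwV hs₀).eventually (hzF.mono fun _ h => h.symm)
  have hderiv := hΦ.hasDerivWithinAt_comp_symm hIJ hwV hs₀ hF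
  rw [hzF.mfderiv_eq] at hderiv
  exact (hderiv.congr_of_eventuallyEq hFw hzF.self_of_nhds.symm).congr_deriv
    ((X s₀).inChart_extChartAt hzc).symm

end Flow

section PushForward

variable {E : Type*} [NormedAddCommGroup E] [NormedSpace ℝ E]
  {M : Type*} [TopologicalSpace M] [ChartedSpace E M]
  {J I : Set ℝ} {X : ℝ → VecField E M} {π : ℝ → BivectorField E M}
  {Φ : ℝ → OpenPartialHomeomorph M M} {V : Set M} {s₀ : ℝ} {y : M}

theorem IsLocalFlow.hasDerivWithinAt_inChart_symm (hΦ : IsLocalFlow J X Φ) (hIJ : I ⊆ J)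
    (hI : UniqueDiffWithinAt ℝ I s₀) (hy : ∀ s ∈ I, y ∈ (Φ s).target) (hs₀ : s₀ ∈ I)
    (hπ : SmoothBivectorFamily J π) (htrans : IsTransportedBy J X π) {c : M}
    (hc : (Φ s₀).symm y = c)
    (hγ : HasDerivWithinAt (fun s => extChartAt 𝓘(ℝ, E) c ((Φ s).symm y))
      ((X s₀).inChart c (extChartAt 𝓘(ℝ, E) c c)) I s₀) :
    HasDerivWithinAt (fun s => (π s).inChart c (extChartAt 𝓘(ℝ, E) c ((Φ s).symm y)))
      (fderiv ℝ ((X s₀).inChart c) (extChartAt 𝓘(ℝ, E) c c) ∘L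
          (π s₀).inChart c (extChartAt 𝓘(ℝ, E) c c)
        + (π s₀).inChart c (extChartAt 𝓘(ℝ, E) c c) ∘L
          .precomp ℝ (fderiv ℝ ((X s₀).inChart c) (extChartAt 𝓘(ℝ, E) c c))) I s₀ := by
  have hcurve : Tendsto (fun s => (Φ s).symm y) (𝓝[I] s₀) (𝓝 c) :=
    hc ▸ hΦ.continuousWithinAt_symm hIJ hy hs₀
  have hsmooth : DifferentiableWithinAt ℝ (fun p : ℝ × E => (π p.1).inChart c p.2)
      (I ×ˢ (extChartAt 𝓘(ℝ, E) c).target) (s₀, extChartAt 𝓘(ℝ, E) c c) :=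
    ((hπ c).mono (prod_mono_left hIJ)).differentiableOn (by simp) _
      ⟨hs₀, mem_extChartAt_target c⟩
  have htime : HasDerivWithinAt (fun s => (π s).inChart c (extChartAt 𝓘(ℝ, E) c c)) _ I s₀ :=
    HasDerivWithinAt.mono (F := (E →L[ℝ] ℝ) →L[ℝ] E) (htrans s₀ (hIJ hs₀) c) hIJ
  exact hasDerivWithinAt_comp_curve_of_lieDerivBivector
    (P := fun p => (π p.1).inChart c p.2) (γ := fun s => extChartAt 𝓘(ℝ, E) c ((Φ s).symm y))
    hs₀ hI (congrArg _ hc) (extChartAt_target_mem_nhds c) hsmooth htime hγ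
    ((hcurve.eventually (extChartAt_source_mem_nhds c)).mono fun _ =>
      (extChartAt 𝓘(ℝ, E) c).map_source)

variable [FiniteDimensional ℝ E] [IsManifold 𝓘(ℝ, E) ∞ M] [T2Space M]

theorem IsLocalFlow.hasDerivWithinAt_pushSharp (hΦ : IsLocalFlow J X Φ) (hIJ : I ⊆ J)
    (hI : UniqueDiffOn ℝ I) (hVo : IsOpen V) (hV : ∀ s ∈ I, V ⊆ (Φ s).target) (hs₀ : s₀ ∈ I)
    (hs₀' : s₀ ∈ closure (interior I)) (hy : y ∈ V) (hπ : SmoothBivectorFamily J π)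
    (hX : ∀ t ∈ J, ∀ c : M, DifferentiableAt ℝ ((X t).inChart c) (extChartAt 𝓘(ℝ, E) c c))
    (htrans : IsTransportedBy J X π) :
    HasDerivWithinAt (fun s => (π s).pushSharp (Φ s) ((Φ s).symm y)) 0 I s₀ := by
  have : IsManifold 𝓘(ℝ, E) 1 M := .of_le (n := ∞) (by simp)
  have hyV : ∀ s ∈ I, y ∈ (Φ s).target := fun s hs => hV s hs hy
  obtain ⟨c, hc⟩ : ∃ c, (Φ s₀).symm y = c := ⟨_, rfl⟩
  have hcs : (Φ s₀).symm y ∈ (extChartAt 𝓘(ℝ, E) c).source := hc ▸ mem_extChartAt_source _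
  have hconj : ∀ᶠ s in 𝓝[I] s₀, (π s).pushSharp (Φ s) ((Φ s).symm y)
      = (fderiv ℝ (symmInCharts (Φ s) c y) (extChartAt 𝓘(ℝ, E) y y)).inverse ∘L
        (π s).inChart c (extChartAt 𝓘(ℝ, E) c ((Φ s).symm y)) ∘L
        .precomp ℝ (fderiv ℝ (symmInCharts (Φ s) c y) (extChartAt 𝓘(ℝ, E) y y)).inverse := by
    filter_upwards [(hΦ.continuousWithinAt_symm hIJ hyV hs₀).eventually_mem
      (extChartAt_source_mem_nhds' hcs), self_mem_nhdsWithin] with s hs hsI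
    exact (π s).pushSharp_eq_conj_inverse (hΦ.mdifferentiable (hIJ hsI)) (hyV s hsI) hs
  have hflow := hΦ.eventually_hasDerivWithinAt_symmInCharts hIJ hVo hV hs₀ hy hc
  have hbase : symmInCharts (Φ s₀) c y (extChartAt 𝓘(ℝ, E) y y) = extChartAt 𝓘(ℝ, E) c c := by
    rw [symmInCharts_extChartAt, hc]
  have hB := hasDerivWithinAt_fderiv_flow
    (ψ := fun p : ℝ × E => symmInCharts (Φ p.1) c y p.2) hI hs₀ hs₀'
    ((continuousOn_extChartAt_symm y).isOpen_inter_preimage (isOpen_extChartAt_target y) hVo)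
    ⟨mem_extChartAt_target y, by rwa [mem_preimage, extChartAt_to_inv]⟩
    ((hΦ.contDiffWithinAt_symmInCharts hIJ hV hs₀ hy hcs).of_le (m := 2)
      (WithTop.coe_le_coe.2 le_top))
    (hbase ▸ hX s₀ (hIJ hs₀) c) hflow
  have hγ := hflow.self_of_nhds
  simp only [symmInCharts_extChartAt, hc] at hγ
  have hp := hΦ.hasDerivWithinAt_inChart_symm hIJ (hI s₀ hs₀) hyV hs₀ hπ htrans hc hγ
  have hzero := hasDerivWithinAt_conj_inverse_eq_zero
    (B := fun s => fderiv ℝ (symmInCharts (Φ s) c y) (extChartAt 𝓘(ℝ, E) y y))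
    (p := fun s => (π s).inChart c (extChartAt 𝓘(ℝ, E) c ((Φ s).symm y)))
    (isInvertible_fderiv_symmInCharts (hΦ.mdifferentiable (hIJ hs₀)) (hyV s₀ hs₀) hcs)
    (hbase ▸ hB) (hc ▸ hp)
  exact hzero.congr_of_eventuallyEq hconj (hconj.self_of_nhdsWithin hs₀)

theorem IsLocalFlow.pushForwardEq (hΦ : IsLocalFlow J X Φ) (hJ : J.OrdConnected)
    (hJ₀ : (0 : ℝ) ∈ J) (hπ : SmoothBivectorFamily J π)
    (hX : ∀ t ∈ J, ∀ c : M, DifferentiableAt ℝ ((X t).inChart c) (extChartAt 𝓘(ℝ, E) c c))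
    (htrans : IsTransportedBy J X π) {t : ℝ} (ht : t ∈ J) :
    PushForwardEq (Φ t) (π t) (π 0) := by
  intro x hx
  have hV : ∀ s ∈ uIcc 0 t, (Φ t).target ⊆ (Φ s).target := hΦ.target_subset t ht
  have hy : Φ t x ∈ (Φ t).target := (Φ t).map_source hx
  suffices (π t).pushSharp (Φ t) ((Φ t).symm (Φ t x)) = (π 0 (Φ t x)).sharp by
    rw [(Φ t).left_inv hx] at this
    exact Bivector.ext this
  rw [← hΦ.pushSharp_zero (π 0) (hV 0 left_mem_uIcc hy)]
  rcases eq_or_ne t 0 with rfl | ht₀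
  · rfl
  have hlt : min 0 t < max 0 t := min_lt_max.2 ht₀.symm
  have hderiv : ∀ s ∈ uIcc 0 t, HasDerivWithinAt
      (fun s => (π s).pushSharp (Φ s) ((Φ s).symm (Φ t x))) 0 (uIcc 0 t) s := fun s hs =>
    hΦ.hasDerivWithinAt_pushSharp (hJ.uIcc_subset hJ₀ ht) (uniqueDiffOn_Icc hlt)
      (Φ t).open_target hV hs (by rwa [uIcc, interior_Icc, closure_Ioo hlt.ne]) hy hπ hX htrans
  exact eq_of_hasDerivWithinAt_zero (F := (E →L[ℝ] ℝ) →L[ℝ] E) (convex_uIcc 0 t) hderiv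
    right_mem_uIcc left_mem_uIcc

end PushForward

end PoissonMoser

end

theorem mainTheorem9_general
    {E : Type*} [NormedAddCommGroup E] [NormedSpace ℝ E] [FiniteDimensional ℝ E]
    {M : Type*} [TopologicalSpace M] [ChartedSpace E M] [IsManifold 𝓘(ℝ, E) ∞ M] [T2Space M]
    (J : Set ℝ) (hJ : J.OrdConnected) (hJ0 : (0 : ℝ) ∈ J)
    (π : ℝ → PoissonMoser.BivectorField E M)
    (Ω : ℝ → PoissonMoser.DiffForm E M 2)
    (a : ℝ → PoissonMoser.DiffForm E M 1)
    (hπ_smooth : PoissonMoser.SmoothBivectorFamily J π)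
    (ha_smooth : PoissonMoser.SmoothFormFamily J a)
    (hπ_poisson : ∀ t ∈ J, PoissonMoser.IsPoisson (π t))
    (h_gauge : ∀ t ∈ J, PoissonMoser.IsGaugeTransform (π 0) (Ω t) (π t))
    (hΩ_deriv : ∀ t ∈ J, ∀ (x : M) (v : Fin 2 → TangentSpace 𝓘(ℝ, E) x),
      HasDerivWithinAt (fun s => Ω s x v) (-(PoissonMoser.DiffForm.d (a t) x v)) J t)
    (Φ : ℝ → OpenPartialHomeomorph M M)
    (hΦ : PoissonMoser.IsLocalFlow J
      (fun t x => (π t x).sharp (PoissonMoser.covector (a t x))) Φ) :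
    ∀ t ∈ J, PoissonMoser.PushForwardEq (Φ t) (π t) (π 0) := by
  have : IsManifold 𝓘(ℝ, E) 1 M := .of_le (n := ∞) (by simp)
  have htrans : PoissonMoser.IsTransportedBy J (fun t => (π t).sharpField (a t)) π :=
    PoissonMoser.isTransportedBy_sharpField hπ_smooth ha_smooth hπ_poisson h_gauge hΩ_deriv
  have hX : ∀ t ∈ J, ∀ c : M, DifferentiableAt ℝ
      (PoissonMoser.VecField.inChart ((π t).sharpField (a t)) c) (extChartAt 𝓘(ℝ, E) c c) :=
    fun t ht c => PoissonMoser.differentiableAt_inChart_sharpField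
      (hπ_smooth.differentiableAt_inChart ht c) (ha_smooth.differentiableAt_inChart ht c)
  exact fun t ht => hΦ.pushForwardEq hJ hJ0 hπ_smooth hX htrans ht

theorem mainTheorem9
    {E : Type*} [NormedAddCommGroup E] [NormedSpace ℝ E] [FiniteDimensional ℝ E]
    {M : Type*} [TopologicalSpace M] [ChartedSpace E M] [IsManifold 𝓘(ℝ, E) ∞ M] [T2Space M]
    (J : Set ℝ) (hJ : J.OrdConnected) (hJ0 : (0 : ℝ) ∈ J)
    (π : ℝ → PoissonMoser.BivectorField E M)
    (Ω : ℝ → PoissonMoser.DiffForm E M 2)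
    (a : ℝ → PoissonMoser.DiffForm E M 1)
    (hπ_smooth : PoissonMoser.SmoothBivectorFamily J π)
    (hΩ_smooth : PoissonMoser.SmoothFormFamily J Ω)
    (ha_smooth : PoissonMoser.SmoothFormFamily J a)
    (hπ_poisson : ∀ t ∈ J, PoissonMoser.IsPoisson (π t))
    (hΩ_closed : ∀ t ∈ J, ∀ x : M, PoissonMoser.DiffForm.d (Ω t) x = 0)
    (h_gauge : ∀ t ∈ J, PoissonMoser.IsGaugeTransform (π 0) (Ω t) (π t))
    (hΩ_deriv : ∀ t ∈ J, ∀ (x : M) (v : Fin 2 → TangentSpace 𝓘(ℝ, E) x),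
      HasDerivWithinAt (fun s => Ω s x v) (-(PoissonMoser.DiffForm.d (a t) x v)) J t)
    (Φ : ℝ → OpenPartialHomeomorph M M)
    (hΦ : PoissonMoser.IsLocalFlow J
      (fun t x => (π t x).sharp (PoissonMoser.covector (a t x))) Φ) :
    ∀ t ∈ J, PoissonMoser.PushForwardEq (Φ t) (π t) (π 0) := by
  exact mainTheorem9_general J hJ hJ0 π Ω a hπ_smooth ha_smooth hπ_poisson h_gauge hΩ_deriv Φ hΦ
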